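/- A semigroup is a nonempty set with an associative binary operation. An inverse semigroup is a semigroup $I$ such that for every $a\in I$ there is a unique $b\in I$ with $aba=a$ and $bab=b$; an inverse subsemigroup of $I$ is a subsemigroup that is itself an inverse semigroup. Let $\sigma_i(I)$ denote the least number of proper inverse subsemigroups of $I$ whose union is $I$ (and $\sigma_i(I)=\infty$ if no finite number of them suffices). For every integer $n\ge 2$ there exists an inverse semigroup $I$ with $\sigma_i(I)=n$. Explicitly, the following are inverse semigroups with the stated covering numbers: (1) $\sigma_i(\mathcal I_X)=2$ for every finite nonempty set $X$, where $\mathcal I_X$ is the symmetric inverse monoid of all partial one-to-one functions from $X$ to $X$ under composition; (2) $\sigma_i(S)=3$ for every finite set $X$ with $|X|\ge 3$, where $S$ is the inverse subsemigroup of $\mathcal I_X$ consisting of all elements that are not bijections $X\to X$; (3) $\sigma_i(S_3)=4$ and $\sigma_i(A_4)=5$, for the symmetric group $S_3$ and the alternating group $A_4$; (4) $\sigma_i\big(\mathcal M^0[\{1,2\},A_n,\{1,2\};I]\big)=n+1$ for every $n\ge 5$, where $A_n$ is the alternating group on $n$ points, $I$ is the $2\times 2$ identity matrix, and $\mathcal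 M^0[\{1,2\},A_n,\{1,2\};I]$ is the Rees $0$-matrix semigroup: the set $(\{1,2\}\times A_n\times\{1,2\})\cup\{0\}$ with $(\kappa,g,\lambda)(\mu,h,\nu)=(\kappa,gh,\nu)$ if $\lambda=\mu$, and all other products equal to $0$. -/

import Mathlib

/-- A semigroup `S` is an inverse semigroup if it is nonempty and every `a` has a unique `b`
with `a b a = a` and `b a b = b`. -/
def IsInverseSemigroup (S : Type*) [Semigroup S] : Prop :=
  Nonempty S ∧ ∀ a : S, ∃! b : S, a * b * a = a ∧ b * a * b = b

/-- A covering of `S` by proper inverse subsemigroups: a set of proper subsemigroups, each of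
which is itself an inverse semigroup, whose union is `S`. -/
def IsInverseCovering {S : Type*} [Semigroup S] (C : Set (Subsemigroup S)) : Prop :=
  (∀ U ∈ C, IsInverseSemigroup U ∧ U ≠ ⊤) ∧ ∀ x : S, ∃ U ∈ C, x ∈ U

/-- The covering number `σ_i(S)` with respect to inverse subsemigroups: the least number of proper
inverse subsemigroups whose union is `S`, and `⊤` if there is no finite covering. -/
noncomputable def inverseCoveringNumber (S : Type*) [Semigroup S] : ℕ∞ :=
  sInf {k : ℕ∞ | ∃ C : Set (Subsemigroup S), IsInverseCovering C ∧ C.encard = k}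

/-- The symmetric inverse monoid on `X`: all partial one-to-one functions from `X` to `X`. -/
def SymmetricInverseMonoid (X : Type*) : Type _ := X ≃. X

namespace SymmetricInverseMonoid

variable {X : Type*}

/-- The product is composition of partial functions, written from left to right. -/
instance : Monoid (SymmetricInverseMonoid X) where
  mul f g := PEquiv.trans f g
  mul_assoc f g h := PEquiv.trans_assoc f g h
  one := PEquiv.refl X
  one_mul f := PEquiv.refl_trans f
  mul_one f := PEquiv.trans_refl f

/-- The partial function underlying an element; `none` means undefined. -/
def app (f : SymmetricInverseMonoid X) : X → Option X := PEquiv.toFun f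

/-- `f` is a bijection from all of `X` onto `X`. -/
def IsBijection (f : SymmetricInverseMonoid X) : Prop :=
  (∀ x, ∃ y, f.app x = some y) ∧ ∀ y, ∃ x, f.app x = some y

theorem app_mul_eq_some (f g : SymmetricInverseMonoid X) (x z : X) :
    (f * g).app x = some z ↔ ∃ y, f.app x = some y ∧ g.app y = some z :=
  PEquiv.trans_eq_some f g x z

theorem app_injective (f : SymmetricInverseMonoid X) {x x' y : X}
    (h : f.app x = some y) (h' : f.app x' = some y) : x = x' :=
  PEquiv.inj f h h'

theorem isBijection_iff [Finite X] (f : SymmetricInverseMonoid X) :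
    f.IsBijection ↔ ∀ x, ∃ y, f.app x = some y := by
  refine ⟨fun h => h.1, fun h => ⟨h, ?_⟩⟩
  choose e he using h
  have hinj : Function.Injective e := fun a b hab =>
    f.app_injective (he a) (by rw [he b, hab])
  intro y
  obtain ⟨x, rfl⟩ := Finite.surjective_of_injective hinj y
  exact ⟨x, he x⟩

/-- For finite `X`, the subsemigroup of the symmetric inverse monoid on `X` that consists of the
elements that are not bijections. -/
def nonBijective (X : Type*) [Finite X] : Subsemigroup (SymmetricInverseMonoid X) where
  carrier := {f | ¬ f.IsBijection}
  mul_mem' := by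
    intro f g hf _ hfg
    refine hf ((isBijection_iff f).2 fun x => ?_)
    obtain ⟨z, hz⟩ := hfg.1 x
    obtain ⟨y, hy, _⟩ := (app_mul_eq_some f g x z).1 hz
    exact ⟨y, hy⟩

end SymmetricInverseMonoid

/-- The Rees 0-matrix semigroup `M⁰[K, G, L; P]` over the matrix `P` with rows indexed by `L`,
columns indexed by `K` and entries in `G ∪ {0}`: the triples in `K × G × L` and a zero. -/
inductive ReesZeroMatrix {K G L : Type*} (P : Matrix L K (WithZero G)) : Type _
  | zero : ReesZeroMatrix P
  | triple (k : K) (g : G) (l : L) : ReesZeroMatrix P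

namespace ReesZeroMatrix

variable {K G L : Type*} {P : Matrix L K (WithZero G)}

/-- The triple `(k, x, l)` for `x` in `G ∪ {0}`, read as the zero if `x = 0`. -/
def ofEntry (k : K) (x : WithZero G) (l : L) : ReesZeroMatrix P :=
  WithZero.recZeroCoe (motive := fun _ => ReesZeroMatrix P) zero (fun g => triple k g l) x

@[simp] theorem ofEntry_zero (k : K) (l : L) :
    (ofEntry k 0 l : ReesZeroMatrix P) = zero := rfl

@[simp] theorem ofEntry_coe (k : K) (g : G) (l : L) :
    (ofEntry k (g : WithZero G) l : ReesZeroMatrix P) = triple k g l := rfl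

variable [Group G]

/-- `(k, g, l) (m, h, n) = (k, g p_{l,m} h, n)` if `p_{l,m} ≠ 0`; all other products are zero. -/
def mul : ReesZeroMatrix P → ReesZeroMatrix P → ReesZeroMatrix P
  | triple k g l, triple m h n => ofEntry k ((g : WithZero G) * P l m * (h : WithZero G)) n
  | _, _ => zero

instance : Mul (ReesZeroMatrix P) := ⟨mul⟩

@[simp] theorem zero_mul' (x : ReesZeroMatrix P) : zero * x = zero := by
  cases x <;> rfl

@[simp] theorem mul_zero' (x : ReesZeroMatrix P) : x * zero = zero := by
  cases x <;> rfl

@[simp] theorem triple_mul_triple (k m : K) (g h : G) (l n : L) :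
    (triple k g l * triple m h n : ReesZeroMatrix P)
      = ofEntry k ((g : WithZero G) * P l m * (h : WithZero G)) n := rfl

theorem ofEntry_mul_triple (k m : K) (x : WithZero G) (h : G) (l n : L) :
    (ofEntry k x l * triple m h n : ReesZeroMatrix P)
      = ofEntry k (x * P l m * (h : WithZero G)) n := by
  induction x using WithZero.recZeroCoe <;> simp

theorem triple_mul_ofEntry (k m : K) (g : G) (x : WithZero G) (l n : L) :
    (triple k g l * ofEntry m x n : ReesZeroMatrix P)
      = ofEntry k ((g : WithZero G) * P l m * x) n := by
  induction x using WithZero.recZeroCoe <;> simp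

instance : Semigroup (ReesZeroMatrix P) where
  mul_assoc a b c := by
    cases a <;> cases b <;> cases c <;>
      simp [ofEntry_mul_triple, triple_mul_ofEntry, mul_assoc]

end ReesZeroMatrix

/-! Upper bounds come from explicit coverings, lower bounds from three different arguments.

For S₃ and A₄ there are 4, resp. 5, elements any two of which generate the group, so no proper
subgroup contains two of them; the same number of subgroups suffices.

The symmetric inverse monoid on a finite set is the union of its bijections and its non-bijections.
For the non-bijections, two proper inverse subsemigroups never suffice: the elements of rank |X| - 1
generate, and any two of them are linked by a third (`three_le_inverseCoveringNumber`). Three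
suffice: `separating t` fails to contain only those elements of rank |X| - 1 for which exactly one
of the two points missing from domain and image is t, and this cannot happen for three points t.

For the Rees semigroup over A_n, a proper inverse subsemigroup with an off-diagonal element meets
each block in at most |A_n| / n elements, because proper subgroups of A_n have index at least n.
Covering block (0, 1) therefore takes n of these. If there were no further member, block (0, 0)
would be covered by n subgroups of order at most |A_n| / n sharing the identity, which is too few
elements. One diagonal subsemigroup and n transporters attain n + 1. -/

section General

/-! ### Inverse subsemigroups and general bounds on the covering number -/

variable {S : Type*} [Semigroup S]

/-- An inverse taken inside `U` is also an inverse in `S`, so uniqueness in `S` identifies it with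
`b`. -/
theorem IsInverseSemigroup.mem_of_inverse (hS : IsInverseSemigroup S) {U : Subsemigroup S}
    (hU : IsInverseSemigroup U) {a b : S} (ha : a ∈ U) (h₁ : a * b * a = a)
    (h₂ : b * a * b = b) : b ∈ U := by
  obtain ⟨c, ⟨hc₁, hc₂⟩, -⟩ := hU.2 ⟨a, ha⟩
  have hbc : b = c := (hS.2 a).unique ⟨h₁, h₂⟩
    ⟨congrArg Subtype.val hc₁, congrArg Subtype.val hc₂⟩
  exact hbc ▸ c.2

theorem IsInverseSemigroup.subsemigroup (hS : IsInverseSemigroup S) {U : Subsemigroup S}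
    (hne : ∃ a, a ∈ U) (h : ∀ a ∈ U, ∃ b ∈ U, a * b * a = a ∧ b * a * b = b) :
    IsInverseSemigroup U := by
  refine ⟨hne.elim fun a ha => ⟨⟨a, ha⟩⟩, fun a => ?_⟩
  obtain ⟨b, hb, h₁, h₂⟩ := h a a.2
  refine ⟨⟨b, hb⟩, ⟨Subtype.ext h₁, Subtype.ext h₂⟩, fun c hc => Subtype.ext ?_⟩
  exact (hS.2 a).unique ⟨congrArg Subtype.val hc.1, congrArg Subtype.val hc.2⟩ ⟨h₁, h₂⟩

theorem inverseCoveringNumber_le {ι : Type*} [Fintype ι] (U : ι → Subsemigroup S)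
    (hU : ∀ i, IsInverseSemigroup (U i)) (hproper : ∀ i, U i ≠ ⊤)
    (hcover : ∀ x, ∃ i, x ∈ U i) : inverseCoveringNumber S ≤ Fintype.card ι := by
  have hC : IsInverseCovering (Set.range U) := by
    refine ⟨?_, fun x => ?_⟩
    · rintro _ ⟨i, rfl⟩
      exact ⟨hU i, hproper i⟩
    · obtain ⟨i, hi⟩ := hcover x
      exact ⟨U i, ⟨i, rfl⟩, hi⟩
  calc inverseCoveringNumber S ≤ (Set.range U).encard := sInf_le ⟨_, hC, rfl⟩
    _ ≤ (Set.univ : Set ι).encard := Set.image_univ (f := U) ▸ Set.encard_image_le _ _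
    _ = Fintype.card ι := by simp

theorem le_inverseCoveringNumber {k : ℕ∞}
    (h : ∀ C : Set (Subsemigroup S), IsInverseCovering C → k ≤ C.encard) :
    k ≤ inverseCoveringNumber S :=
  le_sInf fun _ ⟨C, hC, hk⟩ => hk ▸ h C hC

/-- If no proper inverse subsemigroup contains two of the given elements, then the covering number
is at least the number of these elements. -/
theorem card_le_inverseCoveringNumber {ι : Type*} [Fintype ι] (x : ι → S)
    (h : ∀ U : Subsemigroup S, IsInverseSemigroup U → U ≠ ⊤ →
      ∀ i j, x i ∈ U → x j ∈ U → i = j) :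
    (Fintype.card ι : ℕ∞) ≤ inverseCoveringNumber S := by
  refine le_inverseCoveringNumber fun C hC => ?_
  choose U hUC hxU using fun i => hC.2 (x i)
  have hinj : Function.Injective U := fun i j hij =>
    h (U i) (hC.1 _ (hUC i)).1 (hC.1 _ (hUC i)).2 i j (hxU i) (hij ▸ hxU j)
  calc (Fintype.card ι : ℕ∞) = (Set.range U).encard := by
        rw [← Set.image_univ, hinj.encard_image]; simp
    _ ≤ C.encard := Set.encard_le_encard (Set.range_subset_iff.2 hUC)

theorem two_le_inverseCoveringNumber [Nonempty S] : 2 ≤ inverseCoveringNumber S := by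
  refine le_inverseCoveringNumber fun C hC => ?_
  obtain ⟨x⟩ := ‹Nonempty S›
  obtain ⟨U, hU, -⟩ := hC.2 x
  have : ∃ y, y ∉ U := by
    by_contra! hy
    exact (hC.1 U hU).2 ((Subsemigroup.eq_top_iff' U).2 hy)
  obtain ⟨y, hy⟩ := this
  obtain ⟨V, hV, hyV⟩ := hC.2 y
  have hUV : U ≠ V := fun h => hy (h ▸ hyV)
  rw [← Set.encard_pair hUV]
  exact Set.encard_le_encard (Set.insert_subset hU (Set.singleton_subset_iff.2 hV))

/-- A semigroup with an involution `x ↦ x⁻¹` satisfying `x x⁻¹ x = x` that is generated by a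
connected part `J` is not the union of two proper inverse subsemigroups. -/
theorem three_le_inverseCoveringNumber (hS : IsInverseSemigroup S) (inv : S → S)
    (hinv : ∀ x, x * inv x * x = x) (hinv_inv : ∀ x, inv (inv x) = x)
    (hinv_mul : ∀ x y, inv (x * y) = inv y * inv x) (J : Set S)
    (hgen : ∀ U : Subsemigroup S, IsInverseSemigroup U → J ⊆ U → U = ⊤)
    (hconn : ∀ a ∈ J, ∀ b ∈ J, ∃ c, c * inv c = inv a * a ∧ inv c * c = b * inv b) :
    3 ≤ inverseCoveringNumber S := by
  have hinv' : ∀ x, inv x * x * inv x = inv x := fun x => by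
    simpa [hinv_inv] using hinv (inv x)
  have key : ∀ A B : Subsemigroup S, IsInverseSemigroup A → IsInverseSemigroup B → A ≠ ⊤ →
      B ≠ ⊤ → (∀ x, x ∈ A ∨ x ∈ B) → False := by
    intro A B hA hB hA' hB' hAB
    have memA : ∀ x ∈ A, inv x ∈ A := fun x hx => hS.mem_of_inverse hA hx (hinv x) (hinv' x)
    have memB : ∀ x ∈ B, inv x ∈ B := fun x hx => hS.mem_of_inverse hB hx (hinv x) (hinv' x)
    obtain ⟨a, haJ, ha⟩ := Set.not_subset.1 (mt (hgen A hA) hA')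
    obtain ⟨b, hbJ, hb⟩ := Set.not_subset.1 (mt (hgen B hB) hB')
    -- If c were in B, then c b is not in B, since b = c⁻¹(c b). So c b and b both lie in A, and c =
    -- (c b) b⁻¹ lies in A after all.
    have claim : ∀ a c, a ∉ A → c * inv c = inv a * a → inv c * c = b * inv b → c ∈ A := by
      intro a c ha h₁ h₂
      rcases hAB c with hc | hc
      · exact hc
      · have hcb : c * b ∉ B := fun h => hb <| by
          have := B.mul_mem (memB c hc) h
          rwa [← mul_assoc, h₂, hinv] at this
        have := A.mul_mem ((hAB (c * b)).resolve_right hcb)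
          (memA b ((hAB b).resolve_right hb))
        rwa [mul_assoc, ← h₂, ← mul_assoc, hinv] at this
    obtain ⟨c, h₁, h₂⟩ := hconn a haJ b hbJ
    have hcA : c ∈ A := claim a c ha h₁ h₂
    -- Since (a c)⁻¹(a c) = c⁻¹ c = b b⁻¹, the claim applies to a c as well; then a = (a c) c⁻¹ lies
    -- in A, a contradiction.
    have hac : a * c ∈ A := by
      refine claim (inv a) (a * c) (fun h => ha (hinv_inv a ▸ memA _ h)) ?_ ?_
      · rw [hinv_mul, mul_assoc, ← mul_assoc c, h₁, hinv', hinv_inv]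
      · rw [hinv_mul, mul_assoc, ← mul_assoc _ a, ← h₁, hinv, h₂]
    have := A.mul_mem hac (memA c hcA)
    rw [mul_assoc, h₁, ← mul_assoc, hinv] at this
    exact ha this
  refine le_inverseCoveringNumber fun C hC => ?_
  by_contra! hlt
  have hle : C.encard ≤ 2 := Order.le_of_lt_add_one (hlt.trans_eq (by norm_num))
  obtain ⟨x⟩ := hS.1
  obtain ⟨U, hU, -⟩ := hC.2 x
  have hfin : C.Finite := Set.finite_of_encard_le_coe hle
  have : (C \ {U}).encard ≤ 1 := by
    have h := Set.encard_sdiff_singleton_add_one hU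
    rw [← h] at hle
    have h2 : (2 : ℕ∞) = 1 + 1 := by norm_num
    rw [h2] at hle
    exact (ENat.add_le_add_iff_right (by simp)).1 hle
  rw [Set.encard_le_one_iff_eq] at this
  obtain ⟨V, hV, hCV⟩ : ∃ V ∈ C, C ⊆ {U, V} := by
    rcases this with h | ⟨V, h⟩
    · exact ⟨U, hU, fun W hW => by
        by_contra hne
        exact h.le (show W ∈ C \ {U} from ⟨hW, fun h' => hne (by simp_all)⟩)⟩
    · refine ⟨V, (h.ge rfl).1, fun W hW => ?_⟩
      by_cases hWU : W = U
      · exact Or.inl hWU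
      · exact Or.inr (h.le ⟨hW, hWU⟩)
  refine key U V (hC.1 U hU).1 (hC.1 V hV).1 (hC.1 U hU).2 (hC.1 V hV).2 fun x => ?_
  obtain ⟨W, hW, hx⟩ := hC.2 x
  rcases hCV hW with rfl | rfl
  exacts [Or.inl hx, Or.inr hx]

end General

/-! ### The groups S₃ and A₄ -/

section Groups

variable {G : Type*} [Group G]

variable (G) in
theorem isInverseSemigroup_group : IsInverseSemigroup G :=
  ⟨⟨1⟩, fun a => ⟨a⁻¹, by simp, fun b hb => by
    have : a * b = 1 := by simpa using hb.1
    exact (inv_eq_of_mul_eq_one_right this).symm⟩⟩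

/-- An inverse subsemigroup of a group is a subgroup. -/
theorem exists_subgroup_of_isInverseSemigroup {U : Subsemigroup G} (hU : IsInverseSemigroup U) :
    ∃ H : Subgroup G, ∀ g, g ∈ H ↔ g ∈ U := by
  have hinv : ∀ g ∈ U, g⁻¹ ∈ U := fun g hg =>
    (isInverseSemigroup_group G).mem_of_inverse hU hg (by simp) (by simp)
  obtain ⟨⟨u, hu⟩⟩ := hU.1
  exact ⟨{ U with
    one_mem' := mul_inv_cancel u ▸ U.mul_mem hu (hinv u hu)
    inv_mem' := fun {g} hg => hinv g hg }, fun _ => Iff.rfl⟩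

/-- The subgroups `H i` bound the number from above. The elements `x i` bound it from below: any two
of them generate, so each needs its own member of a covering. -/
theorem inverseCoveringNumber_group {ι : Type*} [Fintype ι] (H : ι → Subgroup G) (x : ι → G)
    (hproper : ∀ i, ∃ g, g ∉ H i) (hcover : ∀ g, ∃ i, g ∈ H i)
    (hgen : ∀ K : Subgroup G, ∀ i j, i ≠ j → x i ∈ K → x j ∈ K → ∀ g, g ∈ K) :
    inverseCoveringNumber G = Fintype.card ι := by
  refine le_antisymm (inverseCoveringNumber_le (fun i => (H i).toSubmonoid.toSubsemigroup)
    (fun i => isInverseSemigroup_group (H i)) (fun i h => ?_) hcover)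
    (card_le_inverseCoveringNumber x fun U hU hU' i j hi hj => ?_)
  · obtain ⟨g, hg⟩ := hproper i
    exact hg (h.ge (Subsemigroup.mem_top g))
  · by_contra hij
    obtain ⟨K, hK⟩ := exists_subgroup_of_isInverseSemigroup hU
    exact hU' ((Subsemigroup.eq_top_iff' U).2 fun g =>
      (hK g).1 (hgen K i j hij ((hK _).2 hi) ((hK _).2 hj) g))

/-- The element `x`, `y` or `1`, according to the letter. -/
def evalLetter (x y : G) : Option Bool → G
  | none => 1
  | some true => x
  | some false => y

theorem evalLetter_mem {K : Subgroup G} {x y : G} (hx : x ∈ K) (hy : y ∈ K) (l : Option Bool) :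
    evalLetter x y l ∈ K := by
  match l with
  | none => exact K.one_mem
  | some true => exact hx
  | some false => exact hy

open Equiv in
theorem inverseCoveringNumber_perm_three : inverseCoveringNumber (Perm (Fin 3)) = 4 := by
  -- A₃ and the three point stabilizers, matched with a 3-cycle and the three transpositions.
  let H : Option (Fin 3) → Subgroup (Perm (Fin 3)) := fun o =>
    o.elim (alternatingGroup (Fin 3)) (fun i => MulAction.stabilizer _ i)
  let x : Option (Fin 3) → Perm (Fin 3) := fun o =>
    o.elim (finRotate 3) (fun i => swap (i + 1) (i + 2))
  -- Words of bounded length turn pairwise generation into a finite check; length three is enough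
  -- here.
  have hgen : ∀ i j : Option (Fin 3), i ≠ j → ∀ g : Perm (Fin 3), ∃ a b c : Option Bool,
      evalLetter (x i) (x j) a * evalLetter (x i) (x j) b * evalLetter (x i) (x j) c = g := by
    decide +kernel
  refine (inverseCoveringNumber_group H x ?_ ?_ ?_).trans (by simp)
  · rintro (_ | i)
    · exact ⟨swap 0 1, by simp [H]⟩
    · refine ⟨finRotate 3, fun h => ?_⟩
      exact (by decide : ∀ i, finRotate 3 i ≠ i) i h
  · intro g
    have : Perm.sign g = 1 ∨ ∃ i, g i = i := by
      revert g
      decide +kernel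
    rcases this with h | ⟨i, h⟩
    · exact ⟨none, h⟩
    · exact ⟨some i, h⟩
  · intro K i j hij hi hj g
    obtain ⟨a, b, c, rfl⟩ := hgen i j hij g
    exact K.mul_mem (K.mul_mem (evalLetter_mem hi hj _) (evalLetter_mem hi hj _))
      (evalLetter_mem hi hj _)

open Equiv in
theorem inverseCoveringNumber_alternatingGroup_four :
    inverseCoveringNumber (alternatingGroup (Fin 4)) = 5 := by
  let V : Subgroup (alternatingGroup (Fin 4)) :=
    { carrier := {g | g * g = 1}
      one_mem' := mul_one 1
      mul_mem' := by
        have : ∀ g h : alternatingGroup (Fin 4), g * g = 1 → h * h = 1 →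
          (g * h) * (g * h) = 1 := by decide +kernel
        exact fun {g h} => this g h
      inv_mem' := fun {g} (hg : g * g = 1) => by
        show g⁻¹ * g⁻¹ = 1
        rw [← mul_inv_rev, hg, inv_one] }
  -- The Klein four-group and the four point stabilizers, matched with a double transposition and
  -- one 3-cycle fixing each point.
  let H : Option (Fin 4) → Subgroup (alternatingGroup (Fin 4)) := fun o =>
    o.elim V (fun i => MulAction.stabilizer _ i)
  let x : Option (Fin 4) → alternatingGroup (Fin 4) := fun o =>
    o.elim ⟨swap 0 1 * swap 2 3, Perm.mem_alternatingGroup.2 (by decide +kernel)⟩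
      (fun i => ⟨swap (i + 1) (i + 2) * swap (i + 2) (i + 3),
        Perm.mem_alternatingGroup.2 (by revert i; decide +kernel)⟩)
  have hgen : ∀ i j : Option (Fin 4), i ≠ j → ∀ g : alternatingGroup (Fin 4),
      ∃ a b c d : Option Bool,
        evalLetter (x i) (x j) a * evalLetter (x i) (x j) b * evalLetter (x i) (x j) c *
          evalLetter (x i) (x j) d = g := by
    decide +kernel
  refine (inverseCoveringNumber_group H x ?_ ?_ ?_).trans (by simp)
  · rintro (_ | i)
    · exact ⟨x (some 0), fun h => (by decide +kernel : ¬ x (some 0) * x (some 0) = 1) h⟩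
    · refine ⟨x none, fun h => ?_⟩
      exact (by decide +kernel : ∀ i, (x none : Perm (Fin 4)) i ≠ i) i h
  · intro g
    have : g * g = 1 ∨ ∃ i, (g : Perm (Fin 4)) i = i := by
      revert g
      decide +kernel
    rcases this with h | ⟨i, h⟩
    · exact ⟨none, h⟩
    · exact ⟨some i, h⟩
  · intro K i j hij hi hj g
    obtain ⟨a, b, c, d, rfl⟩ := hgen i j hij g
    exact K.mul_mem (K.mul_mem (K.mul_mem (evalLetter_mem hi hj _) (evalLetter_mem hi hj _))
      (evalLetter_mem hi hj _)) (evalLetter_mem hi hj _)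

end Groups

/-! ### Inverses, domains and images of partial injections -/

namespace SymmetricInverseMonoid

variable {X : Type*}

theorem ext_app {f g : SymmetricInverseMonoid X}
    (h : ∀ x y, f.app x = some y ↔ g.app x = some y) : f = g :=
  PEquiv.ext fun x => Option.ext (h x)

/-- The inverse partial function. -/
def inv (f : SymmetricInverseMonoid X) : SymmetricInverseMonoid X := PEquiv.symm f

theorem app_inv {f : SymmetricInverseMonoid X} {x y : X} :
    f.inv.app y = some x ↔ f.app x = some y :=
  PEquiv.eq_some_iff f

theorem inv_mul (f g : SymmetricInverseMonoid X) : (f * g).inv = g.inv * f.inv :=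
  PEquiv.symm_trans_rev f g

/-- The domain of a partial function. -/
def dom (f : SymmetricInverseMonoid X) : Set X := {x | ∃ y, f.app x = some y}

/-- The identity function on a subset. -/
noncomputable def idOn (s : Set X) : SymmetricInverseMonoid X :=
  letI := Classical.decPred (· ∈ s)
  PEquiv.ofSet s

/-- A permutation as a partial function. -/
def ofPerm (e : Equiv.Perm X) : SymmetricInverseMonoid X := e.toPEquiv

theorem app_idOn {s : Set X} {x y : X} : (idOn s).app x = some y ↔ x = y ∧ x ∈ s := by
  classical
  exact PEquiv.ofSet_eq_some_iff.trans (by aesop)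

theorem app_ofPerm {e : Equiv.Perm X} {x y : X} : (ofPerm e).app x = some y ↔ e x = y := by
  show some (e x) = some y ↔ _
  simp

theorem mul_inv_eq (f : SymmetricInverseMonoid X) : f * f.inv = idOn f.dom := by
  refine ext_app fun x y => ?_
  rw [app_mul_eq_some, app_idOn]
  constructor
  · rintro ⟨z, h, h'⟩
    exact ⟨f.app_injective h (app_inv.1 h'), z, h⟩
  · rintro ⟨rfl, z, h⟩
    exact ⟨z, h, app_inv.2 h⟩

theorem inv_mul_eq (f : SymmetricInverseMonoid X) : f.inv * f = idOn f.inv.dom :=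
  mul_inv_eq f.inv

theorem mul_inv_mul (f : SymmetricInverseMonoid X) : f * f.inv * f = f := by
  refine ext_app fun x y => ?_
  rw [mul_inv_eq, app_mul_eq_some]
  constructor
  · rintro ⟨z, h, h'⟩
    obtain ⟨rfl, -⟩ := app_idOn.1 h
    exact h'
  · intro h
    exact ⟨x, app_idOn.2 ⟨rfl, y, h⟩, h⟩

theorem inv_mul_inv (f : SymmetricInverseMonoid X) : f.inv * f * f.inv = f.inv :=
  mul_inv_mul f.inv

variable (X) in
theorem isInverseSemigroup : IsInverseSemigroup (SymmetricInverseMonoid X) := by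
  refine ⟨⟨1⟩, fun f => ⟨f.inv, ⟨mul_inv_mul f, inv_mul_inv f⟩, ?_⟩⟩
  -- By injectivity, f g f = f forces g to reverse every arrow of f; exchanging f and g gives
  -- uniqueness of the inverse.
  have aux : ∀ f g : SymmetricInverseMonoid X, f * g * f = f → ∀ x y, f.app x = some y →
      g.app y = some x := by
    intro f g h x y hxy
    have h' := hxy
    rw [← h, app_mul_eq_some] at h'
    obtain ⟨z, hz, hzy⟩ := h'
    obtain ⟨w, hw, hwz⟩ := (app_mul_eq_some _ _ _ _).1 hz
    obtain rfl : z = x := f.app_injective hzy hxy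
    obtain rfl : w = y := by simpa [hxy] using hw.symm
    exact hwz
  rintro g ⟨h₁, h₂⟩
  exact ext_app fun x y => ⟨fun h => app_inv.2 (aux g f h₂ x y h),
    fun h => aux f g h₁ y x (app_inv.1 h)⟩

theorem isBijection_iff_dom {f : SymmetricInverseMonoid X} :
    f.IsBijection ↔ f.dom = Set.univ ∧ f.inv.dom = Set.univ := by
  simp only [IsBijection, dom, Set.eq_univ_iff_forall, Set.mem_ofPred_eq, app_inv]

theorem dom_mul_subset (f g : SymmetricInverseMonoid X) : (f * g).dom ⊆ f.dom := by
  rintro x ⟨z, hz⟩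
  obtain ⟨y, hy, -⟩ := (app_mul_eq_some _ _ _ _).1 hz
  exact ⟨y, hy⟩

theorem dom_inv_subset_of_dom_mul_eq {f g : SymmetricInverseMonoid X}
    (h : (f * g).dom = f.dom) : f.inv.dom ⊆ g.dom := by
  rintro y ⟨x, hx⟩
  rw [app_inv] at hx
  have : x ∈ (f * g).dom := h.ge ⟨y, hx⟩
  obtain ⟨z, hz⟩ := this
  obtain ⟨y', hy', hz⟩ := (app_mul_eq_some _ _ _ _).1 hz
  obtain rfl : y = y' := by simpa [hx] using hy'
  exact ⟨z, hz⟩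

theorem dom_idOn (s : Set X) : (idOn s).dom = s := by
  ext x
  exact ⟨fun ⟨y, hy⟩ => (app_idOn.1 hy).2, fun h => ⟨x, app_idOn.2 ⟨rfl, h⟩⟩⟩

theorem dom_idOn_mul_ofPerm (s : Set X) (e : Equiv.Perm X) : (idOn s * ofPerm e).dom = s := by
  ext x
  constructor
  · exact fun h => dom_idOn s ▸ dom_mul_subset _ _ h
  · exact fun h => ⟨e x, (app_mul_eq_some _ _ _ _).2
      ⟨x, app_idOn.2 ⟨rfl, h⟩, app_ofPerm.2 rfl⟩⟩

theorem dom_inv_idOn_mul_ofPerm (s : Set X) (e : Equiv.Perm X) :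
    (idOn s * ofPerm e).inv.dom = e '' s := by
  ext y
  constructor
  · rintro ⟨x, hx⟩
    obtain ⟨z, hz, hzy⟩ := (app_mul_eq_some _ _ _ _).1 (app_inv.1 hx)
    obtain ⟨rfl, hs⟩ := app_idOn.1 hz
    exact ⟨x, hs, app_ofPerm.1 hzy⟩
  · rintro ⟨x, hx, rfl⟩
    exact ⟨x, app_inv.2 ((app_mul_eq_some _ _ _ _).2
      ⟨x, app_idOn.2 ⟨rfl, hx⟩, app_ofPerm.2 rfl⟩)⟩

theorem ncard_dom_inv (f : SymmetricInverseMonoid X) : f.inv.dom.ncard = f.dom.ncard := by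
  refine Set.ncard_congr (fun y hy => hy.choose) (fun y hy => ⟨y, app_inv.1 hy.choose_spec⟩)
    (fun y z hy hz h => ?_) (fun x hx => ?_)
  · have hy' := app_inv.1 hy.choose_spec
    have hz' := app_inv.1 hz.choose_spec
    rw [h, hz'] at hy'
    exact (Option.some.inj hy').symm
  · obtain ⟨y, hy⟩ := hx
    refine ⟨y, ⟨x, app_inv.2 hy⟩, ?_⟩
    have h : f.inv.dom y := ⟨x, app_inv.2 hy⟩
    exact f.app_injective (app_inv.1 h.choose_spec) hy

theorem isBijection_one : (1 : SymmetricInverseMonoid X).IsBijection :=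
  ⟨fun x => ⟨x, rfl⟩, fun x => ⟨x, rfl⟩⟩

/-- A partial injection that is undefined at `x` and does not attain `z` extends by `x ↦ z`. -/
theorem exists_extension (f : SymmetricInverseMonoid X) {x z : X} (hx : x ∉ f.dom)
    (hz : z ∉ f.inv.dom) : ∃ g : SymmetricInverseMonoid X,
      ∀ a b, g.app a = some b ↔ f.app a = some b ∨ (a = x ∧ b = z) := by
  classical
  have hx' : ∀ b, f.app x ≠ some b := fun b hb => hx ⟨b, hb⟩
  have hz' : ∀ a, f.inv.app z ≠ some a := fun a ha => hz ⟨a, ha⟩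
  have h₁ : ∀ a b, (if a = x then some z else f.app a) = some b ↔
      f.app a = some b ∨ (a = x ∧ b = z) := by
    intro a b
    split_ifs with h
    · subst h
      simp [hx', eq_comm]
    · simp [h]
  have h₂ : ∀ a b, (if b = z then some x else f.inv.app b) = some a ↔
      f.app a = some b ∨ (a = x ∧ b = z) := by
    intro a b
    split_ifs with h
    · subst h
      have : f.app a ≠ some b := fun h => hz' a (app_inv.2 h)
      simp [this, eq_comm]
    · simp [h, app_inv]
  exact ⟨(⟨fun a => if a = x then some z else f.app a,
    fun b => if b = z then some x else f.inv.app b,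
    fun a b => (h₂ a b).trans (h₁ a b).symm⟩ : X ≃. X), h₁⟩

/-! ### Covering numbers 2 and 3: all partial injections, and the non-bijections -/

section Finite

variable [Finite X]

theorem mem_nonBijective_iff {f : SymmetricInverseMonoid X} :
    f ∈ nonBijective X ↔ f.dom ≠ Set.univ := by
  refine not_congr ((isBijection_iff f).trans ?_)
  rw [Set.eq_univ_iff_forall]
  rfl

theorem inv_mem_nonBijective {f : SymmetricInverseMonoid X} (hf : f ∈ nonBijective X) :
    f.inv ∈ nonBijective X := fun h => hf (isBijection_iff_dom.2 (isBijection_iff_dom.1 h).symm)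

theorem isInverseSemigroup_nonBijective [Nonempty X] : IsInverseSemigroup (nonBijective X) := by
  refine (isInverseSemigroup X).subsemigroup ⟨idOn ∅, ?_⟩ fun f hf =>
    ⟨f.inv, inv_mem_nonBijective hf, mul_inv_mul f, inv_mul_inv f⟩
  rw [mem_nonBijective_iff, dom_idOn]
  exact Set.empty_ne_univ

variable (X) in
/-- The subsemigroup of bijections. -/
def bijective : Subsemigroup (SymmetricInverseMonoid X) where
  carrier := {f | f.IsBijection}
  mul_mem' := by
    intro f g hf hg
    refine (isBijection_iff _).2 fun x => ?_
    obtain ⟨y, hy⟩ := hf.1 x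
    obtain ⟨z, hz⟩ := hg.1 y
    exact ⟨z, (app_mul_eq_some _ _ _ _).2 ⟨y, hy, hz⟩⟩

variable (X) in
theorem inverseCoveringNumber_eq_two [Nonempty X] :
    inverseCoveringNumber (SymmetricInverseMonoid X) = 2 := by
  refine le_antisymm ?_ two_le_inverseCoveringNumber
  refine (inverseCoveringNumber_le (fun b : Bool => if b then bijective X else nonBijective X)
    ?_ ?_ ?_).trans (by simp)
  · rintro (_ | _)
    · exact isInverseSemigroup_nonBijective
    · exact (isInverseSemigroup X).subsemigroup ⟨1, isBijection_one⟩ fun f hf =>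
        ⟨f.inv, isBijection_iff_dom.2 (isBijection_iff_dom.1 hf).symm, mul_inv_mul f,
          inv_mul_inv f⟩
  · rintro (_ | _) h
    · exact (h.ge (Subsemigroup.mem_top 1) : ¬ _) isBijection_one
    · have : (idOn ∅ : SymmetricInverseMonoid X).IsBijection := h.ge (Subsemigroup.mem_top _)
      have := (isBijection_iff_dom.1 this).1
      rw [dom_idOn] at this
      exact Set.empty_ne_univ this
  · intro f
    by_cases hf : f.IsBijection
    · exact ⟨true, hf⟩
    · exact ⟨false, hf⟩

/-- The elements of `nonBijective X` that, if they omit only `i` from their domain and only `j`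
from their image, satisfy `i = t ↔ j = t`. -/
def separating (t : X) : Subsemigroup (nonBijective X) where
  carrier := {f | ∀ i j, f.1.dom = {i}ᶜ → f.1.inv.dom = {j}ᶜ → (i = t ↔ j = t)}
  mul_mem' := by
    rintro ⟨f, hf⟩ ⟨g, hg⟩ hfU hgU i k hi hk
    change (f * g).dom = _ at hi
    change (f * g).inv.dom = _ at hk
    rw [mem_nonBijective_iff] at hf hg
    -- If f g omits one point only, then so do both non-bijective factors, and by cardinality the
    -- image of f is the domain of g. The omitted points then form a chain i, j, k to which both
    -- hypotheses apply.
    have full : ∀ {i : X} {s : Set X}, {i}ᶜ ⊆ s → s ≠ Set.univ → s = {i}ᶜ := by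
      intro i s h hs
      refine subset_antisymm (fun x hx hxi => hs ?_) h
      obtain rfl : x = i := hxi
      exact Set.eq_univ_of_forall fun y => (eq_or_ne y x).elim (fun e => e ▸ hx) fun e => h e
    have hdf : f.dom = {i}ᶜ := full (hi ▸ dom_mul_subset f g) hf
    have hig : g.inv.dom = {k}ᶜ := by
      refine full (hk ▸ inv_mul f g ▸ dom_mul_subset _ _) ?_
      exact mem_nonBijective_iff.1 (inv_mem_nonBijective (mem_nonBijective_iff.2 hg))
    have hsub := dom_inv_subset_of_dom_mul_eq (hi.trans hdf.symm)
    have hcard : f.inv.dom.ncard = g.dom.ncard := by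
      rw [ncard_dom_inv, ← ncard_dom_inv g, hdf, hig, Set.ncard_compl, Set.ncard_compl,
        Set.ncard_singleton, Set.ncard_singleton]
    have heq : f.inv.dom = g.dom := Set.eq_of_subset_of_ncard_le hsub hcard.ge
    obtain ⟨j, hj⟩ := (Set.ne_univ_iff_exists_notMem _).1 hg
    have hgj : g.dom = {j}ᶜ := by
      refine Set.eq_of_subset_of_ncard_le (fun x hx e => hj (e ▸ hx)) ?_
      rw [← ncard_dom_inv, hig]
      rw [Set.ncard_compl, Set.ncard_compl, Set.ncard_singleton, Set.ncard_singleton]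
    exact (hfU i j hdf (heq.trans hgj)).trans (hgU j k hgj hig)

/-- The partial permutation `i ↦ j ↦ i` that fixes all other points, restricted to the
complement of `i`. -/
noncomputable def connector [DecidableEq X] (i j : X) : nonBijective X :=
  ⟨idOn {i}ᶜ * ofPerm (Equiv.swap i j), by
    rw [mem_nonBijective_iff, dom_idOn_mul_ofPerm]
    exact fun h => (h.ge (Set.mem_univ i)) rfl⟩

theorem dom_connector [DecidableEq X] (i j : X) : (connector i j).1.dom = {i}ᶜ :=
  dom_idOn_mul_ofPerm _ _

theorem dom_inv_connector [DecidableEq X] (i j : X) : (connector i j).1.inv.dom = {j}ᶜ := by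
  refine (dom_inv_idOn_mul_ofPerm _ _).trans ?_
  rw [Set.image_compl_eq (Equiv.bijective _)]
  simp

/-- An element outside `separating (p t)` has one omitted domain point i and one omitted image point
j, with `p t` in {i, j}. Three distinct points do not fit in {i, j}. -/
theorem inverseCoveringNumber_nonBijective_le (hX : 3 ≤ Nat.card X) :
    inverseCoveringNumber (nonBijective X) ≤ 3 := by
  classical
  have : Fintype X := Fintype.ofFinite X
  have hne : Nonempty X := Finite.card_pos_iff.1 (by omega)
  obtain ⟨p⟩ : Nonempty (Fin 3 ↪ X) :=
    Function.Embedding.nonempty_of_card_le (by simpa using hX)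
  refine (inverseCoveringNumber_le (fun t : Fin 3 => separating (p t)) ?_ ?_ ?_).trans (by simp)
  · intro t
    refine isInverseSemigroup_nonBijective.subsemigroup ⟨connector (p t) (p t), ?_⟩ ?_
    · intro i j hi hj
      rw [dom_connector] at hi
      rw [dom_inv_connector] at hj
      simp_all
    · intro f hf
      refine ⟨⟨f.1.inv, inv_mem_nonBijective f.2⟩, fun i j hi hj => (hf j i hj hi).symm,
        Subtype.ext (mul_inv_mul _), Subtype.ext (inv_mul_inv _)⟩
  · intro t h
    -- This element omits `p t` from its domain but a different point from its image, so it
    -- witnesses properness.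
    have := h.ge (Subsemigroup.mem_top (connector (p t) (p (t + 1)))) _ _
      (dom_connector _ _) (dom_inv_connector _ _)
    exact (by decide : ∀ t : Fin 3, t + 1 ≠ t) t (p.injective (this.1 rfl))
  · intro f
    by_contra! h
    have h' : ∀ t, ∃ i j, f.1.dom = {i}ᶜ ∧ f.1.inv.dom = {j}ᶜ ∧ ¬ (i = p t ↔ j = p t) := by
      intro t
      by_contra! ht
      exact h t ht
    obtain ⟨i, j, hi, hj, -⟩ := h' 0
    have hp : ∀ t, (i = p t ∨ j = p t) := by
      intro t
      obtain ⟨i', j', hi', hj', ht⟩ := h' t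
      obtain rfl : i = i' := by simpa using hi.symm.trans hi'
      obtain rfl : j = j' := by simpa using hj.symm.trans hj'
      tauto
    have h01 := p.injective.ne (show (0 : Fin 3) ≠ 1 by decide)
    have h02 := p.injective.ne (show (0 : Fin 3) ≠ 2 by decide)
    have h12 := p.injective.ne (show (1 : Fin 3) ≠ 2 by decide)
    rcases hp 0 with h0 | h0 <;> rcases hp 1 with h1 | h1 <;> rcases hp 2 with h2 | h2 <;>
      simp_all

variable (X) in
/-- The elements of `nonBijective X` whose domain and image omit only one point. -/
def corankOne : Set (nonBijective X) :=
  {f | ∃ i j, f.1.dom = {i}ᶜ ∧ f.1.inv.dom = {j}ᶜ}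

/-- Induction on the number of omitted points: an element omitting at least two is the restriction
of a one-point extension g, that is, the product of a partial identity omitting one point with g. -/
theorem subsemigroup_eq_top_of_corankOne_subset {U : Subsemigroup (nonBijective X)}
    (hU : corankOne X ⊆ U) : U = ⊤ := by
  classical
  have ind : ∀ m : ℕ, ∀ f : nonBijective X, f.1.domᶜ.ncard = m + 1 → f ∈ U := by
    intro m
    induction m with
    | zero =>
      intro f hf
      have hf' : f.1.inv.domᶜ.ncard = 1 := by
        rw [Set.ncard_compl, ncard_dom_inv, ← Set.ncard_compl, hf]
      obtain ⟨i, hi⟩ := Set.ncard_eq_one.1 hf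
      obtain ⟨j, hj⟩ := Set.ncard_eq_one.1 hf'
      exact hU ⟨i, j, by rw [← hi, compl_compl], by rw [← hj, compl_compl]⟩
    | succ m ih =>
      intro f hf
      have hf' : f.1.inv.domᶜ.ncard = m + 1 + 1 := by
        rw [Set.ncard_compl, ncard_dom_inv, ← Set.ncard_compl, hf]
      obtain ⟨x, hx⟩ := Set.nonempty_of_ncard_ne_zero (s := f.1.domᶜ) (by omega)
      obtain ⟨z, hz⟩ := Set.nonempty_of_ncard_ne_zero (s := f.1.inv.domᶜ) (by omega)
      obtain ⟨g, hg⟩ := exists_extension f.1 hx hz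
      have hgdom : g.domᶜ = f.1.domᶜ \ {x} := by
        ext a
        constructor
        · exact fun ha => ⟨fun ⟨b, hb⟩ => ha ⟨b, (hg a b).2 (Or.inl hb)⟩,
            fun e => ha ⟨z, (hg a z).2 (Or.inr ⟨e, rfl⟩)⟩⟩
        · rintro ⟨ha, hax⟩ ⟨b, hb⟩
          rcases (hg a b).1 hb with h | h
          exacts [ha ⟨b, h⟩, hax h.1]
      have hgcard : g.domᶜ.ncard = m + 1 := by
        rw [hgdom, Set.ncard_sdiff_singleton_of_mem hx, hf]
        omega
      have hgS : g ∈ nonBijective X := by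
        rw [mem_nonBijective_iff]
        intro h
        simp [h] at hgcard
      have : f = connector x x * ⟨g, hgS⟩ := by
        refine Subtype.ext (ext_app fun a b => ?_)
        change _ ↔ ((connector x x).1 * g).app a = some b
        rw [app_mul_eq_some]
        have hc : ∀ a b, (connector x x).1.app a = some b ↔ a = b ∧ a ≠ x := by
          intro a b
          simp [connector, app_mul_eq_some, app_idOn, app_ofPerm]
        simp only [hc, hg]
        constructor
        · intro h
          exact ⟨a, ⟨rfl, fun e => hx ⟨b, e ▸ h⟩⟩, Or.inl h⟩
        · rintro ⟨_, ⟨rfl, h⟩, h' | h'⟩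
          · exact h'
          · exact absurd h'.1 h
      rw [this]
      exact U.mul_mem (hU ⟨x, x, dom_connector _ _, dom_inv_connector _ _⟩) (ih _ hgcard)
  refine (Subsemigroup.eq_top_iff' U).2 fun f => ind (f.1.domᶜ.ncard - 1) f ?_
  have : f.1.domᶜ.ncard ≠ 0 := by
    rw [Ne, Set.ncard_eq_zero, Set.compl_empty_iff]
    exact mem_nonBijective_iff.1 f.2
  omega

-- The idempotents f⁻¹ f and g g⁻¹ are the identities on the image of f and the domain of g, here
-- complements of points j and k; `connector j k` links them.
variable (X) in
theorem three_le_inverseCoveringNumber_nonBijective [Nonempty X] :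
    3 ≤ inverseCoveringNumber (nonBijective X) := by
  classical
  refine three_le_inverseCoveringNumber isInverseSemigroup_nonBijective
    (fun f => ⟨f.1.inv, inv_mem_nonBijective f.2⟩) (fun f => Subtype.ext (mul_inv_mul _))
    (fun _ => rfl) (fun f g => Subtype.ext (inv_mul _ _)) (corankOne X)
    (fun U _ hU => subsemigroup_eq_top_of_corankOne_subset hU) ?_
  rintro f ⟨-, j, -, hj⟩ g ⟨k, -, hk, -⟩
  refine ⟨connector j k, Subtype.ext ?_, Subtype.ext ?_⟩
  · change (connector j k).1 * (connector j k).1.inv = f.1.inv * f.1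
    rw [mul_inv_eq, inv_mul_eq, dom_connector, hj]
  · change (connector j k).1.inv * (connector j k).1 = g.1 * g.1.inv
    rw [mul_inv_eq, inv_mul_eq, dom_inv_connector, hk]

variable (X) in
theorem inverseCoveringNumber_nonBijective (hX : 3 ≤ Nat.card X) :
    inverseCoveringNumber (nonBijective X) = 3 := by
  have : Nonempty X := (Finite.card_pos_iff (α := X)).1 (by omega)
  exact le_antisymm (inverseCoveringNumber_nonBijective_le hX)
    (three_le_inverseCoveringNumber_nonBijective X)

end Finite

end SymmetricInverseMonoid

/-- By simplicity, A_n acts faithfully on the cosets of a proper subgroup. Index below n would give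
n!/2 ≤ (n - 1)!, impossible for n ≥ 5. -/
theorem alternatingGroup.le_index_of_ne_top {n : ℕ} (hn : 5 ≤ n)
    {H : Subgroup (alternatingGroup (Fin n))} (hH : H ≠ ⊤) : n ≤ H.index := by
  by_contra! hlt
  have hsimple : IsSimpleGroup (alternatingGroup (Fin n)) :=
    alternatingGroup.isSimpleGroup (by simpa using hn)
  have : Nontrivial (Fin n) := Fin.nontrivial_iff_two_le.2 (by omega)
  have hcore : H.normalCore = ⊥ :=
    (inferInstance : H.normalCore.Normal).eq_bot_or_eq_top.resolve_right
      fun h => hH (top_le_iff.1 (h ▸ H.normalCore_le))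
  rw [Subgroup.normalCore_eq_ker, MonoidHom.ker_eq_bot_iff] at hcore
  have hle := Nat.card_le_card_of_injective _ hcore
  rw [Nat.card_perm, ← Subgroup.index] at hle
  have h2 := two_mul_nat_card_alternatingGroup (α := Fin n)
  rw [Nat.card_perm, Nat.card_fin] at h2
  obtain ⟨m, rfl⟩ : ∃ m, n = m + 1 := ⟨n - 1, by omega⟩
  have hfac : H.index.factorial ≤ m.factorial := Nat.factorial_le (by omega)
  rw [Nat.factorial_succ] at h2
  have := Nat.factorial_pos m
  nlinarith

/-! ### Rees 0-matrix semigroups over an identity matrix -/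

namespace ReesZeroMatrix

section Identity

variable {K G : Type*} [DecidableEq K] [Group G]

theorem triple_mul_triple_same (k l n : K) (g h : G) :
    (triple k g l * triple l h n : ReesZeroMatrix (1 : Matrix K K (WithZero G)))
      = triple k (g * h) n := by
  rw [triple_mul_triple, Matrix.one_apply_eq, mul_one, ← WithZero.coe_mul, ofEntry_coe]

theorem triple_mul_triple_of_ne {l m : K} (h : l ≠ m) (k n : K) (g g' : G) :
    (triple k g l * triple m g' n : ReesZeroMatrix (1 : Matrix K K (WithZero G))) = zero := by
  rw [triple_mul_triple, Matrix.one_apply_ne h]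
  simp

/-- The inverse of an element of the Rees 0-matrix semigroup over an identity matrix. -/
def inv : ReesZeroMatrix (1 : Matrix K K (WithZero G)) →
    ReesZeroMatrix (1 : Matrix K K (WithZero G))
  | zero => zero
  | triple k g l => triple l g⁻¹ k

theorem mul_inv_mul (x : ReesZeroMatrix (1 : Matrix K K (WithZero G))) : x * inv x * x = x := by
  cases x with
  | zero => rfl
  | triple k g l => rw [inv, triple_mul_triple_same, triple_mul_triple_same, inv_mul_cancel_right]

theorem inv_mul_inv (x : ReesZeroMatrix (1 : Matrix K K (WithZero G))) :
    inv x * x * inv x = inv x := by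
  cases x with
  | zero => rfl
  | triple k g l =>
    rw [inv, triple_mul_triple_same, triple_mul_triple_same, inv_mul_cancel, one_mul]

variable (K G) in
theorem isInverseSemigroup : IsInverseSemigroup (ReesZeroMatrix (1 : Matrix K K (WithZero G))) := by
  refine ⟨⟨zero⟩, fun x => ⟨inv x, ⟨mul_inv_mul x, inv_mul_inv x⟩, ?_⟩⟩
  rintro y ⟨h₁, h₂⟩
  cases x with
  | zero => simpa [inv] using h₂.symm
  | triple k g l =>
    cases y with
    | zero => simp at h₁
    | triple m h n =>
      by_cases hlm : l = m
      · subst hlm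
        by_cases hnk : n = k
        · subst hnk
          simp only [triple_mul_triple_same, triple.injEq, true_and, and_true] at h₁
          have : g * h = 1 := by simpa using h₁
          rw [inv, inv_eq_of_mul_eq_one_right this]
        · rw [triple_mul_triple_same, triple_mul_triple_of_ne hnk] at h₁
          cases h₁
      · simp [triple_mul_triple_of_ne hlm] at h₁

variable (K G) in
/-- The elements whose two indices agree, and the zero. -/
def diagonal : Subsemigroup (ReesZeroMatrix (1 : Matrix K K (WithZero G))) where
  carrier := {x | ∀ k g l, x = triple k g l → k = l}
  mul_mem' := by
    rintro (_ | ⟨k, g, l⟩) (_ | ⟨m, h, n⟩) hx hy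
    · simp
    · simp
    · simp
    · obtain rfl := hx _ _ _ rfl
      obtain rfl := hy _ _ _ rfl
      by_cases hkm : k = m
      · subst hkm
        rintro _ _ _ h
        rw [triple_mul_triple_same] at h
        cases h
        rfl
      · rintro _ _ _ h
        rw [triple_mul_triple_of_ne hkm] at h
        cases h

theorem isInverseSemigroup_diagonal : IsInverseSemigroup (diagonal K G) := by
  refine (isInverseSemigroup K G).subsemigroup ⟨zero, fun _ _ _ h => by cases h⟩ fun x hx =>
    ⟨inv x, ?_, mul_inv_mul x, inv_mul_inv x⟩
  cases x with
  | zero => exact hx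
  | triple k g l =>
    obtain rfl := hx _ _ _ rfl
    intro _ _ _ h
    cases h
    rfl

/-- For a group acting on `Y` and points `p k`, the elements `(k, g, l)` such that `g` maps `p l`
to `p k`, and the zero. -/
def transporter {Y : Type*} [MulAction G Y] (p : K → Y) :
    Subsemigroup (ReesZeroMatrix (1 : Matrix K K (WithZero G))) where
  carrier := {x | ∀ k g l, x = triple k g l → g • p l = p k}
  mul_mem' := by
    rintro (_ | ⟨k, g, l⟩) (_ | ⟨m, h, n⟩) hx hy
    · simp
    · simp
    · simp
    · by_cases hlm : l = m
      · subst hlm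
        rintro _ _ _ h
        rw [triple_mul_triple_same] at h
        cases h
        rw [mul_smul, hy _ _ _ rfl, hx _ _ _ rfl]
      · rintro _ _ _ h
        rw [triple_mul_triple_of_ne hlm] at h
        cases h

theorem isInverseSemigroup_transporter {Y : Type*} [MulAction G Y] (p : K → Y) :
    IsInverseSemigroup (transporter (G := G) p) := by
  refine (isInverseSemigroup K G).subsemigroup ⟨zero, fun _ _ _ h => by cases h⟩ fun x hx =>
    ⟨inv x, ?_, mul_inv_mul x, inv_mul_inv x⟩
  cases x with
  | zero => exact hx
  | triple k g l =>
    intro _ _ _ h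
    cases h
    rw [inv_smul_eq_iff, hx _ _ _ rfl]

end Identity

/-! ### The 2 × 2 case: covering number n + 1 -/

section TwoByTwo

variable {G : Type*} [Group G]

/-- If `G` acts on a finite set without fixed points, then the diagonal elements together with the
elements that transport a base point to `y`, for all `y`, cover the semigroup. -/
theorem inverseCoveringNumber_le_card_add_one {Y : Type*} [Fintype Y] [Nonempty Y]
    [MulAction G Y] (hfix : ∀ y : Y, ∃ g : G, g • y ≠ y) :
    inverseCoveringNumber (ReesZeroMatrix (1 : Matrix (Fin 2) (Fin 2) (WithZero G))) ≤
      Fintype.card Y + 1 := by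
  obtain ⟨y₀⟩ := ‹Nonempty Y›
  refine (inverseCoveringNumber_le (fun o : Option Y =>
    o.elim (diagonal (Fin 2) G) fun y => transporter ![y, y₀]) ?_ ?_ ?_).trans (by simp)
  · rintro (_ | y)
    exacts [isInverseSemigroup_diagonal, isInverseSemigroup_transporter _]
  · rintro (_ | y) h
    · have := h.ge (Subsemigroup.mem_top (triple 0 1 1)) _ _ _ rfl
      exact absurd this (by decide)
    · obtain ⟨g, hg⟩ := hfix y
      exact hg (h.ge (Subsemigroup.mem_top (triple 0 g 0)) _ _ _ rfl)
  · intro x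
    cases x with
    | zero => exact ⟨none, fun _ _ _ h => by cases h⟩
    | triple k g l =>
      by_cases hkl : k = l
      · exact ⟨none, fun _ _ _ h => by cases h; exact hkl⟩
      · by_cases hk : k = 0
        · obtain rfl : l = 1 := by omega
          subst hk
          exact ⟨some (g • y₀), fun _ _ _ h => by cases h; rfl⟩
        · obtain rfl : k = 1 := by omega
          obtain rfl : l = 0 := by omega
          exact ⟨some (g⁻¹ • y₀), fun _ _ _ h => by
            cases h
            exact smul_inv_smul g y₀⟩

/-- The elements `g` with `(k, g, l)` in `U`. -/
def entries (U : Subsemigroup (ReesZeroMatrix (1 : Matrix (Fin 2) (Fin 2) (WithZero G))))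
    (k l : Fin 2) : Set G := {g | triple k g l ∈ U}

theorem mul_mem_entries
    {U : Subsemigroup (ReesZeroMatrix (1 : Matrix (Fin 2) (Fin 2) (WithZero G)))}
    {k l m : Fin 2} {g h : G} (hg : g ∈ entries U k l) (hh : h ∈ entries U l m) :
    g * h ∈ entries U k m := by
  have := U.mul_mem hg hh
  rwa [triple_mul_triple_same] at this

theorem inv_mem_entries
    {U : Subsemigroup (ReesZeroMatrix (1 : Matrix (Fin 2) (Fin 2) (WithZero G)))}
    (hU : IsInverseSemigroup U) {k l : Fin 2} {g : G} (hg : g ∈ entries U k l) :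
    g⁻¹ ∈ entries U l k :=
  (isInverseSemigroup (Fin 2) G).mem_of_inverse hU hg (mul_inv_mul (triple k g l))
    (inv_mul_inv (triple k g l))

/-- Translation by an off-diagonal entry t and its inverse moves block (0, 0) onto every other
block, so if that block were full, `U` would be everything; the zero is the square of (0, t, 1). -/
theorem exists_subgroup_of_entries_nonempty
    {U : Subsemigroup (ReesZeroMatrix (1 : Matrix (Fin 2) (Fin 2) (WithZero G)))}
    (hU : IsInverseSemigroup U) (hne : (entries U 0 1).Nonempty) (htop : U ≠ ⊤) :
    ∃ H : Subgroup G, H ≠ ⊤ ∧ (H : Set G) = entries U 0 0 := by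
  obtain ⟨t, ht⟩ := hne
  have ht' := inv_mem_entries hU ht
  refine ⟨{ carrier := entries U 0 0
            mul_mem' := mul_mem_entries
            one_mem' := mul_inv_cancel t ▸ mul_mem_entries ht ht'
            inv_mem' := inv_mem_entries hU }, fun h => htop ?_, rfl⟩
  have h00 : ∀ g, g ∈ entries U 0 0 := fun g => h.ge (Subgroup.mem_top g)
  have h01 : ∀ g, g ∈ entries U 0 1 := fun g => by
    simpa using mul_mem_entries (h00 (g * t⁻¹)) ht
  have h10 : ∀ g, g ∈ entries U 1 0 := fun g => by
    simpa using mul_mem_entries ht' (h00 (t * g))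
  have h11 : ∀ g, g ∈ entries U 1 1 := fun g => by
    simpa using mul_mem_entries ht' (h01 (t * g))
  refine (Subsemigroup.eq_top_iff' U).2 fun x => ?_
  cases x with
  | zero =>
    rw [← triple_mul_triple_of_ne (show (1 : Fin 2) ≠ 0 by decide) 0 1 t t]
    exact U.mul_mem ht ht
  | triple k g l =>
    fin_cases k <;> fin_cases l
    exacts [h00 g, h01 g, h10 g, h11 g]

theorem ncard_entries_le [Finite G]
    {U : Subsemigroup (ReesZeroMatrix (1 : Matrix (Fin 2) (Fin 2) (WithZero G)))}
    (hU : IsInverseSemigroup U) (hne : (entries U 0 1).Nonempty) :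
    (entries U 0 1).ncard ≤ (entries U 0 0).ncard := by
  obtain ⟨t, ht⟩ := hne
  exact Set.ncard_le_ncard_of_injOn (· * t⁻¹)
    (fun g hg => mul_mem_entries hg (inv_mem_entries hU ht))
    (fun _ _ _ _ h => mul_right_cancel h)

/-- If all proper subgroups of the finite group `G` have index at least `n`, then the covering
number exceeds `n`. -/
theorem lt_inverseCoveringNumber [Finite G] {n : ℕ} (hn : 2 ≤ n)
    (hindex : ∀ H : Subgroup G, H ≠ ⊤ → n ≤ H.index) :
    (n + 1 : ℕ∞) ≤
      inverseCoveringNumber (ReesZeroMatrix (1 : Matrix (Fin 2) (Fin 2) (WithZero G))) := by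
  classical
  have : Fintype G := Fintype.ofFinite G
  refine le_inverseCoveringNumber fun C hC => ?_
  by_contra! hlt
  have hle : C.encard ≤ n := Order.le_of_lt_add_one hlt
  have hfin : C.Finite := Set.finite_of_encard_le_coe hle
  obtain ⟨F, rfl⟩ := hfin.exists_finset_coe
  have hF : F.card ≤ n := by simpa using hle
  have hcover : ∀ k l, ∀ g : G, ∃ U ∈ F, g ∈ entries U k l := fun k l g => hC.2 (triple k g l)
  have hdiag : ∀ U ∈ F, (entries U 0 1).Nonempty →
      n * (entries U 0 0).ncard ≤ Nat.card G ∧ 1 ∈ entries U 0 0 := by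
    intro U hU hne
    obtain ⟨H, hH, hHU⟩ := exists_subgroup_of_entries_nonempty (hC.1 U hU).1 hne (hC.1 U hU).2
    rw [← hHU, ← H.index_mul_card]
    exact ⟨Nat.mul_le_mul_right _ (hindex H hH), H.one_mem⟩
  have hG : 0 < Nat.card G := Nat.card_pos
  -- Each member covers at most |G| / n of block (0, 1), so n members meet it; as |F| ≤ n, all of
  -- them do.
  have hall : ∀ U ∈ F, (entries U 0 1).Nonempty := by
    have hsub : (Set.univ : Set G) ⊆
        ⋃ U ∈ F.filter fun U => (entries U 0 1).Nonempty, entries U 0 1 := by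
      intro g _
      obtain ⟨U, hU, hg⟩ := hcover 0 1 g
      exact Set.mem_biUnion (x := U) (Finset.mem_filter.2 ⟨hU, g, hg⟩) hg
    have h₁ : Nat.card G ≤ ∑ U ∈ F.filter fun U => (entries U 0 1).Nonempty,
        (entries U 0 1).ncard := by
      rw [← Set.ncard_univ]
      exact (Set.ncard_le_ncard hsub (Set.toFinite _)).trans (Finset.set_ncard_biUnion_le _ _)
    have h₂ : n * Nat.card G ≤ (F.filter fun U => (entries U 0 1).Nonempty).card * Nat.card G := by
      refine (Nat.mul_le_mul_left n h₁).trans ?_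
      rw [Finset.mul_sum, ← smul_eq_mul]
      refine Finset.sum_le_card_nsmul _ _ _ fun U hU => ?_
      obtain ⟨hU, hne⟩ := Finset.mem_filter.1 hU
      exact (Nat.mul_le_mul_left n (ncard_entries_le (hC.1 U hU).1 hne)).trans (hdiag U hU hne).1
    have h₃ := Nat.le_of_mul_le_mul_right h₂ hG
    exact Finset.filter_card_eq (le_antisymm (Finset.card_filter_le _ _) (hF.trans h₃))
  -- The identity lies in every `entries U 0 0`, so it is removed before counting: at most n(|G| / n
  -- - 1) = |G| - n other elements are covered, fewer than |G| - 1.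
  have hsub : ({1}ᶜ : Set G) ⊆ ⋃ U ∈ F, (entries U 0 0 \ {1}) := by
    intro g hg
    obtain ⟨U, hU, hgU⟩ := hcover 0 0 g
    exact Set.mem_biUnion (x := U) hU ⟨hgU, hg⟩
  have h₁ : Nat.card G - 1 ≤ ∑ U ∈ F, (entries U 0 0 \ {1}).ncard := by
    have hcompl : ({1}ᶜ : Set G).ncard = Nat.card G - 1 := by
      rw [Set.ncard_compl, Set.ncard_singleton]
    rw [← hcompl]
    exact (Set.ncard_le_ncard hsub (Set.toFinite _)).trans (Finset.set_ncard_biUnion_le _ _)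
  have h₂ : ∀ U ∈ F, n * (entries U 0 0 \ {1}).ncard ≤ Nat.card G - n := by
    intro U hU
    obtain ⟨h, h1⟩ := hdiag U hU (hall U hU)
    rw [Set.ncard_sdiff_singleton_of_mem h1, Nat.mul_sub, mul_one]
    exact Nat.sub_le_sub_right h n
  have h₃ : n * (Nat.card G - 1) ≤ n * (Nat.card G - n) := by
    refine (Nat.mul_le_mul_left n h₁).trans ?_
    rw [Finset.mul_sum]
    refine (Finset.sum_le_card_nsmul _ _ _ h₂).trans ?_
    rw [smul_eq_mul]
    exact Nat.mul_le_mul_right _ hF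
  have h₄ := Nat.le_of_mul_le_mul_left h₃ (by omega)
  have h₅ : Nat.card G ≤ 1 := by omega
  -- Truncated subtraction leaves the case |G| ≤ 1 open; it is excluded by n ≤ |G|.
  have h₆ : n * 1 ≤ Nat.card G := by
    obtain ⟨U, hU, -⟩ := hcover 0 0 1
    obtain ⟨h, h1⟩ := hdiag U hU (hall U hU)
    exact (Nat.mul_le_mul_left n ((Set.ncard_pos (Set.toFinite _)).2 ⟨1, h1⟩)).trans h
  omega

theorem inverseCoveringNumber_alternatingGroup {n : ℕ} (hn : 5 ≤ n) :
    inverseCoveringNumber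
      (ReesZeroMatrix (1 : Matrix (Fin 2) (Fin 2) (WithZero (alternatingGroup (Fin n))))) =
        (n + 1 : ℕ∞) := by
  have : Nonempty (Fin n) := ⟨⟨0, by omega⟩⟩
  refine le_antisymm ?_ (lt_inverseCoveringNumber (by omega) fun H hH =>
    alternatingGroup.le_index_of_ne_top hn hH)
  refine (inverseCoveringNumber_le_card_add_one (Y := Fin n) fun y => ?_).trans (by simp)
  have hpre : MulAction.IsPretransitive (alternatingGroup (Fin n)) (Fin n) :=
    alternatingGroup.isPretransitive_of_three_le_card (Fin n) (by simp; omega)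
  have : Nontrivial (Fin n) := Fin.nontrivial_iff_two_le.2 (by omega)
  obtain ⟨z, hz⟩ := exists_ne y
  obtain ⟨g, hg⟩ := MulAction.exists_smul_eq (alternatingGroup (Fin n)) y z
  exact ⟨g, hg ▸ hz⟩

end TwoByTwo

end ReesZeroMatrix

theorem corollary1 :
    (∀ n : ℕ, 2 ≤ n →
      ∃ (I : Type) (_ : Semigroup I),
        IsInverseSemigroup I ∧ inverseCoveringNumber I = (n : ℕ∞)) ∧
    (∀ (X : Type*) [Finite X] [Nonempty X],
      IsInverseSemigroup (SymmetricInverseMonoid X) ∧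
        inverseCoveringNumber (SymmetricInverseMonoid X) = 2) ∧
    (∀ (X : Type*) [Finite X], 3 ≤ Nat.card X →
      IsInverseSemigroup (SymmetricInverseMonoid.nonBijective X) ∧
        inverseCoveringNumber (SymmetricInverseMonoid.nonBijective X) = 3) ∧
    (IsInverseSemigroup (Equiv.Perm (Fin 3)) ∧
      inverseCoveringNumber (Equiv.Perm (Fin 3)) = 4) ∧
    (IsInverseSemigroup (alternatingGroup (Fin 4)) ∧
      inverseCoveringNumber (alternatingGroup (Fin 4)) = 5) ∧
    (∀ n : ℕ, 5 ≤ n →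
      IsInverseSemigroup
          (ReesZeroMatrix (1 : Matrix (Fin 2) (Fin 2) (WithZero (alternatingGroup (Fin n))))) ∧
        inverseCoveringNumber
          (ReesZeroMatrix (1 : Matrix (Fin 2) (Fin 2) (WithZero (alternatingGroup (Fin n))))) =
          (n + 1 : ℕ∞)) := by
  refine ⟨fun n hn => ?_, fun X _ _ => ⟨SymmetricInverseMonoid.isInverseSemigroup X,
      SymmetricInverseMonoid.inverseCoveringNumber_eq_two X⟩, fun X _ hX => ?_,
    ⟨isInverseSemigroup_group _, inverseCoveringNumber_perm_three⟩,
    ⟨isInverseSemigroup_group _, inverseCoveringNumber_alternatingGroup_four⟩,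
    fun n hn => ⟨ReesZeroMatrix.isInverseSemigroup _ _,
      ReesZeroMatrix.inverseCoveringNumber_alternatingGroup hn⟩⟩
  · obtain rfl | rfl | rfl | rfl | hn : n = 2 ∨ n = 3 ∨ n = 4 ∨ n = 5 ∨ 6 ≤ n := by omega
    · exact ⟨SymmetricInverseMonoid Unit, inferInstance,
        SymmetricInverseMonoid.isInverseSemigroup _,
        SymmetricInverseMonoid.inverseCoveringNumber_eq_two _⟩
    · exact ⟨SymmetricInverseMonoid.nonBijective (Fin 3), inferInstance,
        SymmetricInverseMonoid.isInverseSemigroup_nonBijective,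
        SymmetricInverseMonoid.inverseCoveringNumber_nonBijective _ (by simp)⟩
    · exact ⟨Equiv.Perm (Fin 3), inferInstance, isInverseSemigroup_group _,
        inverseCoveringNumber_perm_three⟩
    · exact ⟨alternatingGroup (Fin 4), inferInstance, isInverseSemigroup_group _,
        inverseCoveringNumber_alternatingGroup_four⟩
    -- From 6 on, the value n is realized by the Rees semigroup over the alternating group of degree
    -- n - 1 ≥ 5.
    · obtain ⟨m, rfl⟩ : ∃ m, n = m + 1 := ⟨n - 1, by omega⟩
      exact ⟨ReesZeroMatrix (1 : Matrix (Fin 2) (Fin 2) (WithZero (alternatingGroup (Fin m)))),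
        inferInstance, ReesZeroMatrix.isInverseSemigroup _ _,
        (ReesZeroMatrix.inverseCoveringNumber_alternatingGroup (by omega)).trans (by simp)⟩
  · have : Nonempty X := (Finite.card_pos_iff (α := X)).1 (by omega)
    exact ⟨SymmetricInverseMonoid.isInverseSemigroup_nonBijective,
      SymmetricInverseMonoid.inverseCoveringNumber_nonBijective X hX⟩
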